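/- Let $Q$ be a plane quadrangulation: a finite connected simple plane graph, taken up to homeomorphism (that is, given by its rotation system and its outer face), all of whose faces, including the outer one, are bounded by cycles of length four, with its vertices properly coloured black and white. The two black vertices on the outer face are named $s_0$ and $s_1$. A *2-orientation* of $Q$ is an orientation of the edges in which every vertex $v \notin \{s_0,s_1\}$ has outdegree two. A *strong labeling* of $Q$ is a map from the angles of $Q$ to $\{0,1\}$ such that - (special vertices) all angles at $s_i$ are labeled $i$, for $i=0,1$; - (vertex rule) at each vertex $v\notin\{s_0,s_1\}$ the incident labels form, cyclically, a non-empty interval of $0$s and a non-empty interval of $1$s; - (edge rule) for each edge, the two incident labels coincide at one endpoint and differ at the other; - (strong face rule) the labels in each face are $0011$ cyclically, and the labels of the outer face, read clockwise in the plane starting at $s_0$, are $0011$. **Statement.** Orienting every edge towards its endpoint at which the two incident labels coincide defines a bijection from the strong labelings of $Q$ to the 2-orientations of $Q$. Its inverse is described as follows. Given a 2-orientation $X$ of $Q$, give label $0$ to all angles at $s_0$ and propagate labels by two rules: - (walking rule) when walking along the boundary of a face with the face on the right-hand side, the label changes exactly when moving from a black to a white vertex; - (edges) the two angles at the tip of an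 oriented edge, on its two sides, have the same label. This propagation assigns to every angle exactly one label, and the resulting labeling is the strong labeling corresponding to $X$. -/

import Mathlib

/-- A finite connected plane simple graph (with at least one edge), given by its rotation system:
`rot d` is the next dart counterclockwise after `d` among the darts leaving `d.fst`.  The darts
leaving a vertex form a single `rot`-cycle.  The field `euler` says that the surface carrying the
rotation system is the sphere, and `outerDart` is a dart having the outer face on its right. -/
structure PlaneGraph (V : Type*) [Finite V] where
  graph : SimpleGraph V
  connected : graph.Connected
  rot : Equiv.Perm graph.Dart
  rot_fst : ∀ d, (rot d).fst = d.fst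
  rot_sameCycle : ∀ d e : graph.Dart, d.fst = e.fst → rot.SameCycle d e
  outerDart : graph.Dart
  euler : Nat.card V +
      Nat.card (Quotient (Equiv.Perm.SameCycle.setoid
        (rot * SimpleGraph.Dart.symm_involutive.toPerm (SimpleGraph.Dart.symm (G := graph))))) =
    graph.edgeSet.ncard + 2

namespace PlaneGraph

variable {V : Type*} [Finite V]

/-- The darts of a plane graph.  A dart `d` also stands for an angle: the angle at `d.fst` between
`d` and the preceding dart in counterclockwise order, `P.rot⁻¹ d`.  This angle lies in the
face to the right of `d`.  So the two angles at `d.fst` incident to the edge of `d` are `d` (on the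
right of `d`) and `P.rot d` (on the left of `d`). -/
abbrev Dart (P : PlaneGraph V) : Type _ := P.graph.Dart

/-- Walking along the boundary of a face, keeping the face on the right: from the dart `uv` to the
next dart `vw` counterclockwise after `vu`.  For a bounded face this is the clockwise walk; for the
outer face it is the counterclockwise walk around the drawing. -/
def faceNext (P : PlaneGraph V) : Equiv.Perm P.Dart :=
  P.rot * SimpleGraph.Dart.symm_involutive.toPerm (SimpleGraph.Dart.symm (G := P.graph))

/-- Two darts (or angles) belong to the same face. -/
def SameFace (P : PlaneGraph V) (d e : P.Dart) : Prop := P.faceNext.SameCycle d e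

/-- The dart (or angle) `d` belongs to the outer face. -/
def InOuterFace (P : PlaneGraph V) (d : P.Dart) : Prop := P.SameFace P.outerDart d

/-- The vertex `v` is on the outer face. -/
def OnOuterFace (P : PlaneGraph V) (v : V) : Prop := ∃ d : P.Dart, d.fst = v ∧ P.InOuterFace d

/-- An orientation of the edges, as the set of darts that point in the direction of their edge:
exactly one of the two darts of every edge is chosen. -/
def IsOrientation (P : PlaneGraph V) (X : Set P.Dart) : Prop :=
  ∀ d : P.Dart, Xor (d ∈ X) (d.symm ∈ X)

/-- The number of edges that leave `v` in the orientation `X`. -/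
noncomputable def outdegree (P : PlaneGraph V) (X : Set P.Dart) (v : V) : ℕ :=
  {d : P.Dart | d ∈ X ∧ d.fst = v}.ncard

end PlaneGraph

/-- A plane quadrangulation with black and white colour classes: every face (the outer one
included) is bounded by a cycle of length four.  The two black vertices on the outer face are
named `s₀` and `s₁`. -/
structure PlaneQuadrangulation (V : Type*) [Finite V] extends PlaneGraph V where
  face_four : ∀ d : toPlaneGraph.Dart, (toPlaneGraph.faceNext ^ 4) d = d ∧
    [d.fst, (toPlaneGraph.faceNext d).fst, ((toPlaneGraph.faceNext ^ 2) d).fst,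
      ((toPlaneGraph.faceNext ^ 3) d).fst].Nodup
  /-- The set of black vertices; the other vertices are white. -/
  black : Set V
  bipartite : ∀ u v : V, graph.Adj u v → Xor (u ∈ black) (v ∈ black)
  s₀ : V
  s₁ : V
  s₀_ne_s₁ : s₀ ≠ s₁
  s₀_black : s₀ ∈ black
  s₁_black : s₁ ∈ black
  s₀_outer : toPlaneGraph.OnOuterFace s₀
  s₁_outer : toPlaneGraph.OnOuterFace s₁

namespace PlaneQuadrangulation

variable {V : Type*} [Finite V]

/-- A 2-orientation: every vertex except `s₀`, `s₁` has outdegree two. -/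
structure IsTwoOrientation (Q : PlaneQuadrangulation V) (X : Set Q.Dart) : Prop where
  isOrientation : Q.IsOrientation X
  outdegree_eq_two : ∀ v : V, v ≠ Q.s₀ → v ≠ Q.s₁ → Q.outdegree X v = 2

/-- A strong labeling of the angles. -/
structure IsStrongLabeling (Q : PlaneQuadrangulation V) (l : Q.Dart → Fin 2) : Prop where
  /-- All angles at `s₀` are labeled `0`. -/
  special_zero : ∀ d : Q.Dart, d.fst = Q.s₀ → l d = 0
  /-- All angles at `s₁` are labeled `1`. -/
  special_one : ∀ d : Q.Dart, d.fst = Q.s₁ → l d = 1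
  /-- Vertex rule: the labels around any other vertex `v`, read once around `v` from a suitable
  angle on, are `k ≥ 1` zeros followed by `deg v - k ≥ 1` ones. -/
  vertex_rule : ∀ v : V, v ≠ Q.s₀ → v ≠ Q.s₁ →
    ∃ d : Q.Dart, d.fst = v ∧ ∃ k : ℕ, 0 < k ∧ k < (Q.graph.neighborSet v).ncard ∧
      (∀ j < k, l ((Q.rot ^ j) d) = 0) ∧
      (∀ j, k ≤ j → j < (Q.graph.neighborSet v).ncard → l ((Q.rot ^ j) d) = 1)
  /-- Edge rule: the two labels incident to an edge coincide at exactly one of its ends. -/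
  edge_rule : ∀ d : Q.Dart, Xor (l d = l (Q.rot d)) (l d.symm = l (Q.rot d.symm))
  /-- Strong face rule: the labels in each face are `0011` cyclically. -/
  face_rule : ∀ e : Q.Dart, ∃ d : Q.Dart, Q.SameFace e d ∧
    l d = 0 ∧ l (Q.faceNext d) = 0 ∧ l ((Q.faceNext ^ 2) d) = 1 ∧ l ((Q.faceNext ^ 3) d) = 1
  /-- The labels of the outer face in clockwise order (that is, with the outer face on the left)
  starting at `s₀` are `0011`. -/
  outer_rule : ∀ d : Q.Dart, Q.InOuterFace d → d.fst = Q.s₀ →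
    l d = 0 ∧ l (Q.faceNext⁻¹ d) = 0 ∧ l ((Q.faceNext⁻¹ ^ 2) d) = 1 ∧
      l ((Q.faceNext⁻¹ ^ 3) d) = 1

/-- The orientation induced by a labeling: every edge points to its end with two coincident
labels. -/
def inducedOrientation (Q : PlaneQuadrangulation V) (l : Q.Dart → Fin 2) : Set Q.Dart :=
  {d | l d.symm = l (Q.rot d.symm)}

open Classical in
/-- `Q.Propagates X d i`: the label `i` for the angle `d` is inferred from the labels `0` at `s₀`
by means of the oriented edges and the walking rule. -/
inductive Propagates (Q : PlaneQuadrangulation V) (X : Set Q.Dart) : Q.Dart → Fin 2 → Prop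
  /-- The angles at `s₀` get the label `0`. -/
  | start (d : Q.Dart) (h : d.fst = Q.s₀) : Propagates Q X d 0
  /-- Walking rule: walking along a face which is kept on the right, the label changes precisely
  when moving from a black to a white vertex. -/
  | walk (d : Q.Dart) (i : Fin 2) (h : Propagates Q X d i) :
      Propagates Q X (Q.faceNext d) (if d.fst ∈ Q.black then 1 - i else i)
  /-- The label at the tip of an oriented edge is copied from its left to its right side. -/
  | copyRight (d : Q.Dart) (hd : d ∈ X) (i : Fin 2) (h : Propagates Q X d.symm i) :
      Propagates Q X (Q.rot d.symm) i
  /-- The label at the tip of an oriented edge is copied from its right to its left side. -/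
  | copyLeft (d : Q.Dart) (hd : d ∈ X) (i : Fin 2) (h : Propagates Q X (Q.rot d.symm) i) :
      Propagates Q X d.symm i

end PlaneQuadrangulation

/-! The sphere is cut into cells: the angles are the 0-cells, the steps `faceNext` and `rot` the
1-cells, and vertices, faces and edges the 2-cells, an edge being the quadrilateral on its four
incident angles. A labeling is a function modulo two on the 0-cells.

For a strong labeling the differences along all 1-cells are known: along `faceNext` they follow the
colours (`walkingRule`), along `rot` they follow the induced orientation, since labels differ
exactly at the tail of an edge. Connectedness carries the label 0 from `s₀` to every angle
(`propagates_iff`), so the orientation determines the labeling.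

Conversely, the differences prescribed by a 2-orientation sum to zero around each 2-cell: a face has
two black corners, outdegrees are even, and an edge has one black end and one tail. As the first
cohomology of the sphere vanishes (`range_coboundary`), they integrate to a labeling
(`exists_labeling`). Euler's formula forces outdegree zero at `s₀` and `s₁` (`outdegree_special`),
so labels are constant there; two changes around any other vertex give two intervals. -/

namespace PlaneGraph

variable {V : Type*} [Finite V] (P : PlaneGraph V)

/-! ### Rotation orbits and counts -/

instance : Finite P.Dart :=
  Finite.of_injective (fun d => d.toProd) fun _ _ h => SimpleGraph.Dart.ext _ _ h

@[simp]
theorem faceNext_apply (d : P.Dart) : P.faceNext d = P.rot d.symm := rfl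

theorem pow_rot_fst (n : ℕ) (d : P.Dart) : ((P.rot ^ n) d).fst = d.fst := by
  induction n with
  | zero => rfl
  | succ n ih => rw [pow_succ', Equiv.Perm.mul_apply, P.rot_fst, ih]

theorem exists_pow_rot_eq {d e : P.Dart} (h : d.fst = e.fst) : ∃ n : ℕ, (P.rot ^ n) d = e := by
  obtain ⟨n, -, hn⟩ := (P.rot_sameCycle d e h).exists_pow_eq'
  exact ⟨n, hn⟩

/-- A set of darts closed under rotation and reversal is empty or contains every dart. -/
theorem dart_induction {S : P.Dart → Prop} (hrot : ∀ d, S d → S (P.rot d))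
    (hsymm : ∀ d, S d → S d.symm) {d₀ : P.Dart} (h₀ : S d₀) (d : P.Dart) : S d := by
  have hpow (n : ℕ) (d : P.Dart) (hd : S d) : S ((P.rot ^ n) d) := by
    induction n with
    | zero => exact hd
    | succ n ih => rw [pow_succ', Equiv.Perm.mul_apply]; exact hrot _ ih
  have hvertex {d e : P.Dart} (h : d.fst = e.fst) (hd : S d) : S e := by
    obtain ⟨n, rfl⟩ := P.exists_pow_rot_eq h
    exact hpow n d hd
  have hwalk {u v : V} (w : P.graph.Walk u v) (hu : ∀ d : P.Dart, d.fst = u → S d) :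
      ∀ d : P.Dart, d.fst = v → S d := by
    induction w with
    | nil => exact hu
    | @cons u v _ h p ih =>
      refine ih fun d hd => ?_
      exact hvertex (d := (⟨(u, v), h⟩ : P.Dart).symm) hd.symm (hsymm _ (hu _ rfl))
  obtain ⟨w⟩ := P.connected d₀.fst d.fst
  exact hwalk w (fun e he => hvertex he.symm h₀) d rfl

theorem exists_dart_fst (v : V) : ∃ d : P.Dart, d.fst = v := by
  have : Nontrivial V := ⟨_, _, P.outerDart.fst_ne_snd⟩
  obtain ⟨w, hw⟩ := P.connected.preconnected.exists_adj_of_nontrivial v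
  exact ⟨⟨(v, w), hw⟩, rfl⟩

/-- The darts leaving `v` correspond to the neighbours of `v`. -/
theorem ncard_dart_fst (v : V) :
    {d : P.Dart | d.fst = v}.ncard = (P.graph.neighborSet v).ncard := by
  refine Set.ncard_congr (fun d _ => d.snd) ?_ ?_ ?_
  · rintro d rfl
    exact d.adj
  · rintro d e rfl he h
    exact SimpleGraph.Dart.ext _ _ (Prod.ext he.symm h)
  · intro w hw
    exact ⟨⟨(v, w), hw⟩, rfl, rfl⟩

theorem minimalPeriod_rot (d : P.Dart) :
    Function.minimalPeriod P.rot d = (P.graph.neighborSet d.fst).ncard := by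
  set m := Function.minimalPeriod P.rot d
  have hm : 0 < m := Function.minimalPeriod_pos_of_mem_periodicPts
    (Function.Injective.mem_periodicPts P.rot.injective d)
  rw [← ncard_dart_fst]
  have himage : {e : P.Dart | e.fst = d.fst} = (fun n => P.rot^[n] d) '' Set.Iio m := by
    ext e
    constructor
    · intro he
      obtain ⟨n, rfl⟩ := P.exists_pow_rot_eq (d := d) (e := e) he.symm
      refine ⟨n % m, Nat.mod_lt _ hm, ?_⟩
      simp only [Equiv.Perm.coe_pow]
      exact Function.iterate_mod_minimalPeriod_eq
    · rintro ⟨n, -, rfl⟩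
      simp only [Set.mem_ofPred_eq, ← Equiv.Perm.coe_pow, pow_rot_fst]
  rw [himage, Function.iterate_injOn_Iio_minimalPeriod.ncard_image, Set.ncard_eq_toFinset_card']
  simp [m]

theorem degree_pos (d : P.Dart) : 0 < (P.graph.neighborSet d.fst).ncard := by
  rw [← minimalPeriod_rot]
  exact Function.minimalPeriod_pos_of_mem_periodicPts
    (Function.Injective.mem_periodicPts P.rot.injective d)

theorem pow_degree_rot (d : P.Dart) : (P.rot ^ (P.graph.neighborSet d.fst).ncard) d = d := by
  rw [← minimalPeriod_rot, Equiv.Perm.coe_pow]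
  exact Function.iterate_minimalPeriod

theorem exists_pow_rot_eq_lt {d e : P.Dart} (h : d.fst = e.fst) :
    ∃ n < (P.graph.neighborSet d.fst).ncard, (P.rot ^ n) d = e := by
  obtain ⟨n, rfl⟩ := P.exists_pow_rot_eq h
  rw [← minimalPeriod_rot]
  refine ⟨n % _, Nat.mod_lt _ ((P.minimalPeriod_rot d).symm ▸ P.degree_pos d), ?_⟩
  simp only [Equiv.Perm.coe_pow]
  exact Function.iterate_mod_minimalPeriod_eq

theorem pow_rot_injOn {d : P.Dart} {m n : ℕ} (hm : m < (P.graph.neighborSet d.fst).ncard)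
    (hn : n < (P.graph.neighborSet d.fst).ncard) (h : (P.rot ^ m) d = (P.rot ^ n) d) : m = n := by
  rw [← minimalPeriod_rot] at hm hn
  simp only [Equiv.Perm.coe_pow] at h
  exact Function.iterate_injOn_Iio_minimalPeriod hm hn h

/-- The faces, as cycles of `faceNext`. -/
abbrev Face : Type _ := Quotient (Equiv.Perm.SameCycle.setoid P.faceNext)

/-- The face to the right of a dart. -/
def face (d : P.Dart) : P.Face := Quotient.mk _ d

theorem face_faceNext (d : P.Dart) : P.face (P.faceNext d) = P.face d :=
  Quotient.sound (s := Equiv.Perm.SameCycle.setoid P.faceNext)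
    (Equiv.Perm.SameCycle.refl _ _).apply_left

/-- The edge carrying a dart. -/
def dartEdge (d : P.Dart) : P.graph.edgeSet := ⟨d.edge, d.edge_mem⟩

theorem dartEdge_symm (d : P.Dart) : P.dartEdge d.symm = P.dartEdge d :=
  Subtype.ext d.edge_symm

theorem card_euler :
    Nat.card V + Nat.card P.Face = Nat.card P.graph.edgeSet + 2 := by
  have := P.euler
  rwa [← Nat.card_coe_set_eq] at this

theorem card_dart : Nat.card P.Dart = 2 * Nat.card P.graph.edgeSet := by
  classical
  have := Fintype.ofFinite V
  rw [Nat.card_eq_fintype_card, Nat.card_eq_fintype_card,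
    P.graph.dart_card_eq_twice_card_edges, SimpleGraph.card_edgeSet]

/-! ### Vanishing of the first cohomology modulo two -/

section Cohomology

open scoped Classical in
/-- The incidence matrix between the vertices, faces and edges, as 2-cells, and the steps
`d ↦ faceNext d` (left summand) and `d ↦ rot d` (right summand), as 1-cells. -/
noncomputable def cellMatrix :
    Matrix (V ⊕ P.Face ⊕ P.graph.edgeSet) (P.Dart ⊕ P.Dart) (ZMod 2)
  | .inl _, .inl _ => 0
  | .inl v, .inr d => if d.fst = v then 1 else 0
  | .inr (.inl f), .inl d => if P.face d = f then 1 else 0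
  | .inr (.inl _), .inr _ => 0
  | .inr (.inr e), .inl d => if P.dartEdge d = e then 1 else 0
  | .inr (.inr e), .inr d => if P.dartEdge d = e then 1 else 0

/-- The coboundary of a function on the angles. -/
def coboundary : (P.Dart → ZMod 2) →ₗ[ZMod 2] (P.Dart ⊕ P.Dart → ZMod 2) where
  toFun h := Sum.elim (fun d => h (P.faceNext d) - h d) (fun d => h (P.rot d) - h d)
  map_add' g h := by
    ext (d | d) <;> simp <;> ring
  map_smul' c h := by
    ext (d | d) <;> simp <;> ring

theorem finrank_ker_coboundary_le :
    Module.finrank (ZMod 2) (LinearMap.ker P.coboundary) ≤ 1 := by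
  have hconst (h : P.Dart → ZMod 2) (hh : P.coboundary h = 0) (d : P.Dart) :
      h d = h P.outerDart := by
    have hface (d : P.Dart) : h (P.faceNext d) = h d :=
      sub_eq_zero.1 (congrFun hh (.inl d))
    have hrot (d : P.Dart) : h (P.rot d) = h d := sub_eq_zero.1 (congrFun hh (.inr d))
    refine P.dart_induction (S := fun d => h d = h P.outerDart) (fun d hd => (hrot d).trans hd)
      (fun d hd => ?_) rfl d
    -- `faceNext` is reversal followed by `rot`, so invariance under both gives invariance under
    -- reversal.
    rw [← hd, ← hface d, faceNext_apply, hrot]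
  refine finrank_le_one ⟨fun _ => 1, ?_⟩ ?_
  · ext (d | d) <;> simp [coboundary]
  · rintro ⟨h, hh⟩
    refine ⟨h P.outerDart, Subtype.ext (funext fun d => ?_)⟩
    simpa using (hconst h hh d).symm

/-- Differences telescope around a vertex or a face. Around an edge the four angles cancel in pairs,
because `faceNext d = rot d.symm`. -/
theorem cellMatrix_mulVec_coboundary [Fintype P.Dart] (h : P.Dart → ZMod 2) :
    P.cellMatrix.mulVec (P.coboundary h) = 0 := by
  classical
  ext (v | f | e)
  · simp only [Matrix.mulVec, dotProduct, Fintype.sum_sum_type, cellMatrix, coboundary,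
      LinearMap.coe_mk, AddHom.coe_mk, Sum.elim_inl, Sum.elim_inr, zero_mul,
      Finset.sum_const_zero, sub_zero, zero_add, mul_sub, Finset.sum_sub_distrib, Pi.zero_apply]
    rw [sub_eq_zero]
    refine Fintype.sum_equiv P.rot _ _ fun d => ?_
    rw [P.rot_fst]
  · simp only [Matrix.mulVec, dotProduct, Fintype.sum_sum_type, cellMatrix, coboundary,
      LinearMap.coe_mk, AddHom.coe_mk, Sum.elim_inl, Sum.elim_inr, zero_mul,
      Finset.sum_const_zero, sub_zero, add_zero, mul_sub, Finset.sum_sub_distrib, Pi.zero_apply]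
    rw [sub_eq_zero]
    refine Fintype.sum_equiv P.faceNext _ _ fun d => ?_
    rw [P.face_faceNext]
  · simp only [Matrix.mulVec, dotProduct, Fintype.sum_sum_type, cellMatrix, coboundary,
      LinearMap.coe_mk, AddHom.coe_mk, Sum.elim_inl, Sum.elim_inr,
      mul_sub, Finset.sum_sub_distrib, Pi.zero_apply]
    have : ∑ d, (if P.dartEdge d = e then (1 : ZMod 2) else 0) * h (P.faceNext d) =
        ∑ d, (if P.dartEdge d = e then (1 : ZMod 2) else 0) * h (P.rot d) := by
      refine Fintype.sum_equiv (SimpleGraph.Dart.symm_involutive.toPerm _) _ _ fun d => ?_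
      simp [P.dartEdge_symm]
    rw [this, CharTwo.add_self_eq_zero]

variable [Fintype V] [Fintype P.Face] [Fintype P.graph.edgeSet]

/-- Each 1-cell borders an edge and either a face or a vertex, and a kernel vector agrees on these
two 2-cells; connectedness makes it constant. -/
theorem finrank_ker_cellMatrix_transpose_le :
    Module.finrank (ZMod 2) (LinearMap.ker P.cellMatrix.transpose.mulVecLin) ≤ 1 := by
  classical
  have hker (x : V ⊕ P.Face ⊕ P.graph.edgeSet → ZMod 2)
      (hx : P.cellMatrix.transpose.mulVec x = 0) :
      ∀ c, x c = x (.inl P.outerDart.fst) := by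
    have hface (d : P.Dart) : x (.inr (.inl (P.face d))) = x (.inr (.inr (P.dartEdge d))) := by
      exact CharTwo.add_eq_zero.1 (by
        simpa [Matrix.mulVec, dotProduct, cellMatrix] using congrFun hx (.inl d))
    have hvert (d : P.Dart) : x (.inl d.fst) = x (.inr (.inr (P.dartEdge d))) := by
      exact CharTwo.add_eq_zero.1 (by
        simpa [Matrix.mulVec, dotProduct, cellMatrix] using congrFun hx (.inr d))
    have hall (d : P.Dart) : x (.inl d.fst) = x (.inl P.outerDart.fst) := by
      refine P.dart_induction (S := fun d => x (.inl d.fst) = x (.inl P.outerDart.fst))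
        (fun d hd => ?_) (fun d hd => ?_) rfl d
      · rwa [P.rot_fst]
      · rw [hvert, P.dartEdge_symm, ← hvert, hd]
    rintro (v | f | ⟨e, he⟩)
    · obtain ⟨d, rfl⟩ := P.exists_dart_fst v
      exact hall d
    · induction f using Quotient.inductionOn with
      | h d => exact (hface d).trans ((hvert d).symm.trans (hall d))
    · induction e with
      | h u v => exact (hvert (⟨(u, v), he⟩ : P.Dart)).symm.trans (hall _)
  refine finrank_le_one ⟨fun _ => 1, ?_⟩ ?_
  · ext (d | d) <;> simp [Matrix.vecMul, dotProduct, cellMatrix, CharTwo.add_self_eq_zero]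
  · rintro ⟨x, hx⟩
    refine ⟨x (.inl P.outerDart.fst), Subtype.ext (funext fun c => ?_)⟩
    simpa using (hker x hx c).symm

/-- The first cohomology of the sphere with coefficients modulo two vanishes. -/
theorem range_coboundary [Fintype P.Dart] :
    LinearMap.range P.coboundary = LinearMap.ker P.cellMatrix.mulVecLin := by
  classical
  refine Submodule.eq_of_le_of_finrank_le ?_ ?_
  · rintro _ ⟨h, rfl⟩
    exact P.cellMatrix_mulVec_coboundary h
  · have h₁ := P.coboundary.finrank_range_add_finrank_ker
    have h₂ := P.cellMatrix.mulVecLin.finrank_range_add_finrank_ker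
    have h₃ := P.cellMatrix.transpose.mulVecLin.finrank_range_add_finrank_ker
    have h₄ : Module.finrank (ZMod 2) (LinearMap.range P.cellMatrix.transpose.mulVecLin) =
        Module.finrank (ZMod 2) (LinearMap.range P.cellMatrix.mulVecLin) :=
      P.cellMatrix.rank_transpose
    have h₅ := P.finrank_ker_coboundary_le
    have h₆ := P.finrank_ker_cellMatrix_transpose_le
    have h₇ := P.card_euler
    have h₈ := P.card_dart
    simp only [Module.finrank_fintype_fun_eq_card, Fintype.card_sum] at h₁ h₂ h₃
    simp only [Nat.card_eq_fintype_card] at h₇ h₈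
    -- With `E` edges there are `2E` angles, `4E` steps and `V + F + E = 2E + 2` 2-cells. The
    -- coboundary has rank at least `2E - 1`; the matrix has rank at least `2E + 1`, so its kernel
    -- has dimension at most `2E - 1`.
    omega

end Cohomology

open scoped Classical in
/-- Prescribed differences modulo two along `faceNext` and `rot` are integrable as soon as they add
up to zero around every face, vertex and edge. -/
theorem exists_potential (a b : P.Dart → ZMod 2) [Fintype P.Dart]
    (hface : ∀ f, ∑ d with P.face d = f, a d = 0)
    (hvert : ∀ v, ∑ d with d.fst = v, b d = 0)
    (hedge : ∀ d : P.Dart, a d + a d.symm + (b d + b d.symm) = 0) :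
    ∃ h : P.Dart → ZMod 2, (∀ d, h (P.faceNext d) = h d + a d) ∧ ∀ d, h (P.rot d) = h d + b d := by
  have := Fintype.ofFinite V
  have := Fintype.ofFinite P.Face
  have := Fintype.ofFinite P.graph.edgeSet
  have hmem : Sum.elim a b ∈ LinearMap.range P.coboundary := by
    rw [range_coboundary, LinearMap.mem_ker, Matrix.mulVecLin_apply]
    ext (v | f | ⟨e, he⟩)
    · simpa [Matrix.mulVec, dotProduct, cellMatrix, Finset.sum_filter] using hvert v
    · simpa [Matrix.mulVec, dotProduct, cellMatrix, Finset.sum_filter] using hface f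
    · obtain ⟨d, rfl⟩ : ∃ d : P.Dart, d.edge = e := by
        induction e with
        | h u v => exact ⟨⟨(u, v), he⟩, rfl⟩
      have hpair (c : P.Dart → ZMod 2) : ∑ x with P.dartEdge x = P.dartEdge d, c x =
          c d + c d.symm := by
        rw [← Finset.sum_pair d.symm_ne.symm]
        refine Finset.sum_congr ?_ fun _ _ => rfl
        ext x
        simp [dartEdge, Subtype.ext_iff, SimpleGraph.dart_edge_eq_iff]
      have := hedge d
      rw [← hpair, ← hpair] at this
      simpa [Matrix.mulVec, dotProduct, cellMatrix, Finset.sum_filter, dartEdge] using this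
  obtain ⟨h, hh⟩ := hmem
  exact ⟨h, fun d => eq_add_of_sub_eq' (congrFun hh (.inl d)),
    fun d => eq_add_of_sub_eq' (congrFun hh (.inr d))⟩

end PlaneGraph

/-! ### Outdegrees and label changes around a vertex -/

namespace PlaneGraph

variable {V : Type*} [Finite V] (P : PlaneGraph V)

open scoped Classical in
theorem outdegree_eq_sum [Fintype P.Dart] (X : Set P.Dart) (v : V) :
    P.outdegree X v = ∑ d with d.fst = v, if d ∈ X then 1 else 0 := by
  rw [outdegree, Set.ncard_eq_toFinset_card', Finset.sum_boole, Finset.filter_filter]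
  simp [and_comm]

/-- The outdegrees of an orientation add up to the number of edges. -/
theorem sum_outdegree [Fintype V] {X : Set P.Dart} (hX : P.IsOrientation X) :
    ∑ v, P.outdegree X v = Nat.card P.graph.edgeSet := by
  classical
  have := Fintype.ofFinite P.Dart
  have hsum : ∑ v, P.outdegree X v = ∑ d, if d ∈ X then 1 else 0 := by
    simp_rw [outdegree_eq_sum]
    exact Finset.sum_fiberwise _ _ _
  have hsymm : ∑ d : P.Dart, (if d ∈ X then 1 else 0) = ∑ d : P.Dart, if d.symm ∈ X then 1 else 0 :=
    Fintype.sum_equiv (SimpleGraph.Dart.symm_involutive.toPerm _) _ _ fun d => by simp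
  have htotal : ∑ d : P.Dart, (if d ∈ X then 1 else 0) + ∑ d : P.Dart, (if d.symm ∈ X then 1 else 0) =
      Nat.card P.Dart := by
    rw [← Finset.sum_add_distrib, Nat.card_eq_fintype_card, Fintype.card_eq_sum_ones]
    refine Finset.sum_congr rfl fun d _ => ?_
    rcases hX d with ⟨h₁, h₂⟩ | ⟨h₁, h₂⟩ <;> simp [h₁, h₂]
  have := P.card_dart
  omega

theorem outdegree_eq_zero_iff (X : Set P.Dart) (v : V) :
    P.outdegree X v = 0 ↔ ∀ d : P.Dart, d.fst = v → d ∉ X := by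
  rw [outdegree, Set.ncard_eq_zero, Set.eq_empty_iff_forall_notMem]
  exact forall_congr' fun d => ⟨fun h hd hX => h ⟨hX, hd⟩, fun h hd => h hd.2 hd.1⟩

/-- Labels around a vertex that change from `1` to `0` at exactly one place and from `0` to `1` at
exactly one place form two intervals. -/
theorem exists_intervals {l : P.Dart → Fin 2} {v : V}
    (h : {d : P.Dart | l d ≠ l (P.rot d) ∧ d.fst = v}.ncard = 2) :
    ∃ d : P.Dart, d.fst = v ∧ ∃ k : ℕ, 0 < k ∧ k < (P.graph.neighborSet v).ncard ∧
      (∀ j < k, l ((P.rot ^ j) d) = 0) ∧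
      (∀ j, k ≤ j → j < (P.graph.neighborSet v).ncard → l ((P.rot ^ j) d) = 1) := by
  classical
  have := Fintype.ofFinite P.Dart
  let S (i j : Fin 2) : Finset P.Dart := {d | d.fst = v ∧ l d = i ∧ l (P.rot d) = j}
  have hchange : (S 1 0).card + (S 0 1).card = 2 := by
    refine Eq.trans ?_ h
    rw [Set.ncard_eq_toFinset_card', ← Finset.card_union_of_disjoint]
    · congr 1
      ext d
      simp only [S, Finset.mem_union, Finset.mem_filter, Finset.mem_univ, Set.mem_toFinset,
        Set.mem_ofPred_eq, true_and]
      generalize l d = x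
      generalize l (P.rot d) = y
      fin_cases x <;> fin_cases y <;> simp
    · rw [Finset.disjoint_left]
      intro d h₁ h₂
      simp only [S, Finset.mem_filter] at h₁ h₂
      simp [h₁.2.2.1] at h₂
  -- `rot` permutes the darts at `v`, so `l d` and `l (rot d)` equal 1 equally often; rises and
  -- falls are therefore equally many, one of each.
  have hbalance : (S 1 0).card + (S 1 1).card = (S 0 1).card + (S 1 1).card := by
    have h₁ : (S 1 0).card + (S 1 1).card = ({d | d.fst = v ∧ l d = 1} : Finset P.Dart).card := by
      rw [← Finset.card_union_of_disjoint]
      · congr 1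
        ext d
        simp only [S, Finset.mem_union, Finset.mem_filter, Finset.mem_univ, true_and]
        generalize l (P.rot d) = y
        fin_cases y <;> simp
      · rw [Finset.disjoint_left]
        intro d h₁ h₂
        simp only [S, Finset.mem_filter] at h₁ h₂
        simp [h₁.2.2.2] at h₂
    have h₂ : (S 0 1).card + (S 1 1).card =
        ({d | d.fst = v ∧ l (P.rot d) = 1} : Finset P.Dart).card := by
      rw [← Finset.card_union_of_disjoint]
      · congr 1
        ext d
        simp only [S, Finset.mem_union, Finset.mem_filter, Finset.mem_univ, true_and]
        generalize l d = y
        fin_cases y <;> simp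
      · rw [Finset.disjoint_left]
        intro d h₁ h₂
        simp only [S, Finset.mem_filter] at h₁ h₂
        simp [h₁.2.2.1] at h₂
    rw [h₁, h₂]
    symm
    refine Finset.card_equiv P.rot fun d => ?_
    simp [P.rot_fst]
  obtain ⟨c, hc⟩ := Finset.card_eq_one.1 (show (S 1 0).card = 1 by omega)
  have hmem (d : P.Dart) : (d.fst = v ∧ l d = 1 ∧ l (P.rot d) = 0) ↔ d = c := by
    rw [← Finset.mem_singleton (a := c), ← hc]
    simp [S]
  obtain ⟨hcv, hc1, hc0⟩ := (hmem c).2 rfl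
  have hdv : (P.rot c).fst = v := by rw [P.rot_fst, hcv]
  obtain ⟨m, hm, hmc⟩ := P.exists_pow_rot_eq_lt (d := P.rot c) (e := c) (P.rot_fst c)
  have hn := P.pow_degree_rot (P.rot c)
  have hinj := fun j => P.pow_rot_injOn (d := P.rot c) (m := j) (n := m)
  rw [hdv] at hm hn hinj
  set n := (P.graph.neighborSet v).ncard
  have hex : ∃ j, l ((P.rot ^ j) (P.rot c)) = 1 := ⟨m, by rw [hmc, hc1]⟩
  -- Reading starts just after the unique fall `c`; `k` is the position of the first 1.
  refine ⟨P.rot c, hdv, Nat.find hex, ?_, ?_, ?_, ?_⟩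
  · rw [Nat.find_pos]
    simp [hc0]
  · exact (Nat.find_le (by rw [hmc, hc1])).trans_lt hm
  · intro j hj
    have := Nat.find_min hex hj
    generalize l ((P.rot ^ j) (P.rot c)) = x at this
    fin_cases x <;> simp_all
  · intro j hj
    induction j, hj using Nat.le_induction with
    | base => exact fun _ => Nat.find_spec hex
    | succ j hj ih =>
      intro hjn
      have hj1 := ih (by omega)
      -- Another fall would be `c` again, after which the reading returns to its start before
      -- completing a full turn.
      by_contra hne
      have hj0 : l (P.rot ((P.rot ^ j) (P.rot c))) = 0 := by
        rw [pow_succ', Equiv.Perm.mul_apply] at hne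
        generalize l (P.rot ((P.rot ^ j) (P.rot c))) = x at hne
        fin_cases x <;> simp_all
      have hjc := (hmem _).1 ⟨(P.pow_rot_fst j _).trans hdv, hj1, hj0⟩
      have hjm := hinj j (by omega) hm (hjc.trans hmc.symm)
      have hback : P.rot c = (P.rot ^ (j + 1)) (P.rot c) := by
        rw [pow_succ', Equiv.Perm.mul_apply, hjc]
      have := P.pow_rot_injOn (d := P.rot c) (m := 0) (n := j + 1)
        (by rw [hdv]; omega) (by rwa [hdv]) (by simpa using hback)
      omega

/-- Labels around a vertex that form two intervals change exactly twice. -/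
theorem ncard_changes {l : P.Dart → Fin 2} {v : V} {d : P.Dart} (hd : d.fst = v) {k : ℕ}
    (hk : 0 < k) (hkn : k < (P.graph.neighborSet v).ncard)
    (hzero : ∀ j < k, l ((P.rot ^ j) d) = 0)
    (hone : ∀ j, k ≤ j → j < (P.graph.neighborSet v).ncard → l ((P.rot ^ j) d) = 1) :
    {d : P.Dart | l d ≠ l (P.rot d) ∧ d.fst = v}.ncard = 2 := by
  subst hd
  set n := (P.graph.neighborSet d.fst).ncard with hn
  have hsucc (j : ℕ) : P.rot ((P.rot ^ j) d) = (P.rot ^ (j + 1)) d := by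
    rw [pow_succ', Equiv.Perm.mul_apply]
  have hlast : (P.rot ^ (n - 1 + 1)) d = d := by
    rw [Nat.sub_add_cancel (by omega)]
    exact P.pow_degree_rot d
  -- The changes occur after the last 0 and, wrapping around to `d`, after the last 1.
  have hset : {e : P.Dart | l e ≠ l (P.rot e) ∧ e.fst = d.fst} =
      {(P.rot ^ (k - 1)) d, (P.rot ^ (n - 1)) d} := by
    ext e
    simp only [Set.mem_ofPred_eq, Set.mem_insert_iff, Set.mem_singleton_iff]
    constructor
    · rintro ⟨hne, he⟩
      obtain ⟨j, hj, rfl⟩ := P.exists_pow_rot_eq_lt he.symm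
      rw [hsucc] at hne
      by_contra! hcon
      have h₁ : j ≠ k - 1 := by rintro rfl; exact hcon.1 rfl
      have h₂ : j ≠ n - 1 := by rintro rfl; exact hcon.2 rfl
      rcases lt_or_ge j k with h | h
      · exact hne (by rw [hzero j h, hzero (j + 1) (by omega)])
      · exact hne (by rw [hone j h hj, hone (j + 1) (by omega) (by omega)])
    · rintro (rfl | rfl)
      · refine ⟨?_, P.pow_rot_fst _ _⟩
        rw [hsucc, hzero _ (by omega), hone _ (by omega) (by omega)]
        decide
      · refine ⟨?_, P.pow_rot_fst _ _⟩
        rw [hsucc, hlast, hone _ (by omega) (by omega)]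
        have := hzero 0 hk
        rw [pow_zero, Equiv.Perm.one_apply] at this
        rw [this]
        decide
  rw [hset, Set.ncard_pair]
  intro h
  have := P.pow_rot_injOn (by omega) (by omega) h
  omega

end PlaneGraph

/-! ### Faces of length four -/

namespace PlaneQuadrangulation

variable {V : Type*} [Finite V] (Q : PlaneQuadrangulation V)

theorem faceNext_fst (d : Q.Dart) : (Q.faceNext d).fst = d.snd := Q.rot_fst _

theorem rot_eq_faceNext_symm (d : Q.Dart) : Q.rot d = Q.faceNext d.symm := by simp

theorem symm_fst_mem_black (d : Q.Dart) : d.symm.fst ∈ Q.black ↔ d.fst ∉ Q.black := by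
  have := Q.bipartite _ _ d.adj
  rw [xor_iff_iff_not] at this
  exact ⟨fun h h' => this.1 h' h, fun h => by_contra fun h' => h (this.2 h')⟩

theorem faceNext_fst_mem_black (d : Q.Dart) : (Q.faceNext d).fst ∈ Q.black ↔ d.fst ∉ Q.black := by
  rw [← symm_fst_mem_black, faceNext_fst]
  rfl

theorem faceNext_four (d : Q.Dart) :
    Q.faceNext (Q.faceNext (Q.faceNext (Q.faceNext d))) = d := (Q.face_four d).1

theorem faceNext_inv (d : Q.Dart) :
    Q.faceNext⁻¹ d = Q.faceNext (Q.faceNext (Q.faceNext d)) := by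
  rw [Equiv.Perm.inv_eq_iff_eq, faceNext_four]

theorem faceNext_inv_sq (d : Q.Dart) : (Q.faceNext⁻¹ ^ 2) d = Q.faceNext (Q.faceNext d) := by
  rw [pow_two, Equiv.Perm.mul_apply, faceNext_inv Q d, Equiv.Perm.inv_eq_iff_eq]

theorem faceNext_inv_cube (d : Q.Dart) : (Q.faceNext⁻¹ ^ 3) d = Q.faceNext d := by
  rw [pow_succ', Equiv.Perm.mul_apply, faceNext_inv_sq, Equiv.Perm.inv_eq_iff_eq]

theorem sameFace_iff (d e : Q.Dart) : Q.SameFace d e ↔ e = d ∨ e = Q.faceNext d ∨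
    e = Q.faceNext (Q.faceNext d) ∨ e = Q.faceNext (Q.faceNext (Q.faceNext d)) := by
  constructor
  · intro h
    obtain ⟨n, -, rfl⟩ := h.exists_pow_eq'
    clear h
    induction n with
    | zero => exact .inl rfl
    | succ n ih =>
      rw [pow_succ', Equiv.Perm.mul_apply]
      rcases ih with h | h | h | h <;> rw [h]
      · exact .inr (.inl rfl)
      · exact .inr (.inr (.inl rfl))
      · exact .inr (.inr (.inr rfl))
      · exact .inl (Q.faceNext_four d)
  · have h := Equiv.Perm.SameCycle.refl Q.faceNext d
    rintro (rfl | rfl | rfl | rfl)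
    · exact h
    · exact h.apply_right
    · exact h.apply_right.apply_right
    · exact h.apply_right.apply_right.apply_right

open scoped Classical in
theorem sum_face {M : Type*} [AddCommMonoid M] [Fintype Q.Dart] (c : Q.Dart → M) (d : Q.Dart) :
    ∑ e with Q.face e = Q.face d, c e = c d + (c (Q.faceNext d) + (c (Q.faceNext (Q.faceNext d)) +
      c (Q.faceNext (Q.faceNext (Q.faceNext d))))) := by
  have hset : ({e | Q.face e = Q.face d} : Finset Q.Dart) = {d, Q.faceNext d,
      Q.faceNext (Q.faceNext d), Q.faceNext (Q.faceNext (Q.faceNext d))} := by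
    ext e
    have : Q.face e = Q.face d ↔ Q.SameFace d e :=
      (Quotient.eq (r := Equiv.Perm.SameCycle.setoid Q.faceNext)).trans
        Equiv.Perm.sameCycle_comm
    simp [-PlaneGraph.faceNext_apply, this, sameFace_iff]
  have hnodup : [d, Q.faceNext d, Q.faceNext (Q.faceNext d),
      Q.faceNext (Q.faceNext (Q.faceNext d))].Nodup :=
    List.Nodup.of_map (fun d : Q.Dart => d.fst) (Q.face_four d).2
  simp only [List.nodup_cons, List.mem_cons, List.not_mem_nil, or_false, not_or] at hnodup
  obtain ⟨⟨h₁, h₂, h₃⟩, ⟨h₄, h₅⟩, h₆, -⟩ := hnodup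
  rw [hset, Finset.sum_insert (by simp only [Finset.mem_insert, Finset.mem_singleton]; tauto),
    Finset.sum_insert (by simp only [Finset.mem_insert, Finset.mem_singleton]; tauto),
    Finset.sum_pair h₆]

theorem card_dart_eq_four_mul : Nat.card Q.Dart = 4 * Nat.card Q.Face := by
  classical
  have := Fintype.ofFinite Q.Dart
  have := Fintype.ofFinite Q.Face
  rw [Nat.card_eq_fintype_card, Nat.card_eq_fintype_card, Fintype.card_eq_sum_ones,
    ← Finset.sum_fiberwise Finset.univ Q.face]
  have (f : Q.Face) : ∑ d with Q.face d = f, 1 = 4 := by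
    induction f using Quotient.inductionOn with
    | h d => exact Q.sum_face (fun _ => 1) d
  simp only [this, Finset.sum_const, Finset.card_univ, smul_eq_mul, mul_comm]

variable {Q}

/-! ### From strong labelings to 2-orientations -/

section Labeling

variable {l : Q.Dart → Fin 2}

open Classical in
/-- The walking rule for a labeling. -/
def WalkingRule (Q : PlaneQuadrangulation V) (l : Q.Dart → Fin 2) (d : Q.Dart) : Prop :=
  l (Q.faceNext d) = if d.fst ∈ Q.black then 1 - l d else l d

theorem WalkingRule.black {d : Q.Dart} (h : WalkingRule Q l d) (hd : d.fst ∈ Q.black) :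
    l (Q.faceNext d) = 1 - l d := by
  rw [h, if_pos hd]

theorem WalkingRule.white {d : Q.Dart} (h : WalkingRule Q l d) (hd : d.fst ∉ Q.black) :
    l (Q.faceNext d) = l d := by
  rw [h, if_neg hd]

theorem label_faceNext_faceNext (h : ∀ d, WalkingRule Q l d) (d : Q.Dart) :
    l (Q.faceNext (Q.faceNext d)) = 1 - l d := by
  by_cases hd : d.fst ∈ Q.black
  · rw [(h _).white (by simpa only [faceNext_fst_mem_black, not_not] using hd), (h d).black hd]
  · rw [(h _).black ((Q.faceNext_fst_mem_black d).2 hd), (h d).white hd]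

namespace IsStrongLabeling

theorem label_faceNext_faceNext (h : Q.IsStrongLabeling l) (e : Q.Dart) :
    l (Q.faceNext (Q.faceNext e)) = 1 - l e := by
  obtain ⟨d, hed, h₀, h₁, h₂, h₃⟩ := h.face_rule e
  rw [PlaneGraph.SameFace, Equiv.Perm.sameCycle_comm] at hed
  change l (Q.faceNext (Q.faceNext d)) = 1 at h₂
  change l (Q.faceNext (Q.faceNext (Q.faceNext d))) = 1 at h₃
  rcases (Q.sameFace_iff d e).1 hed with rfl | rfl | rfl | rfl
  · rw [h₀, h₂]; rfl
  · rw [h₁, h₃]; rfl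
  · rw [faceNext_four, h₂, h₀]; rfl
  · rw [faceNext_four, h₃, h₁]; rfl

/-- Opposite corners of a face have complementary labels, so changing and non-changing steps
alternate, as the colours do. -/
theorem walkingRule_faceNext (h : Q.IsStrongLabeling l) {d : Q.Dart} (hd : WalkingRule Q l d) :
    WalkingRule Q l (Q.faceNext d) := by
  rw [WalkingRule, h.label_faceNext_faceNext]
  by_cases hb : d.fst ∈ Q.black
  · rw [if_neg (by simpa only [faceNext_fst_mem_black, not_not] using hb), hd.black hb]
  · rw [if_pos ((Q.faceNext_fst_mem_black d).2 hb), hd.white hb]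

/-- The number of changes around the quadrilateral of an edge is even. By the edge rule one `rot`
step changes, so exactly one of the two `faceNext` steps does; exactly one end is black. -/
theorem walkingRule_symm (h : Q.IsStrongLabeling l) {d : Q.Dart} (hd : WalkingRule Q l d) :
    WalkingRule Q l d.symm := by
  have hedge := h.edge_rule d
  unfold WalkingRule at hd ⊢
  rw [← rot_eq_faceNext_symm]
  rw [PlaneGraph.faceNext_apply] at hd
  have hcol := Q.symm_fst_mem_black d
  generalize l d = x, l (Q.rot d) = y, l d.symm = z, l (Q.rot d.symm) = w at hd hedge ⊢
  by_cases hb : d.fst ∈ Q.black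
  · rw [if_pos hb] at hd
    rw [if_neg (by tauto)]
    clear hcol
    decide +revert
  · rw [if_neg hb] at hd
    rw [if_pos (hcol.2 hb)]
    clear hcol
    decide +revert

theorem walkingRule (h : Q.IsStrongLabeling l) (d : Q.Dart) : WalkingRule Q l d := by
  obtain ⟨d₀, hd₀, hout⟩ := Q.s₀_outer
  refine Q.dart_induction (S := WalkingRule Q l) (fun d hd => ?_)
    (fun d hd => h.walkingRule_symm hd) (d₀ := d₀) ?_ d
  · rw [rot_eq_faceNext_symm]
    exact h.walkingRule_faceNext (h.walkingRule_symm hd)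
  -- The outer rule seeds the induction: three steps back along a face of length four are one step
  -- forward, from label 0 at the black vertex `s₀` to label 1.
  · obtain ⟨h₀, -, -, h₃⟩ := h.outer_rule d₀ hout hd₀
    rw [faceNext_inv_cube] at h₃
    rw [WalkingRule, if_pos (hd₀ ▸ Q.s₀_black), h₃, h₀]
    rfl

theorem mem_inducedOrientation_iff (h : Q.IsStrongLabeling l) (d : Q.Dart) :
    d ∈ Q.inducedOrientation l ↔ l d ≠ l (Q.rot d) := by
  have := h.edge_rule d
  rw [xor_iff_not_iff] at this
  change l d.symm = l (Q.rot d.symm) ↔ _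
  tauto

theorem isTwoOrientation (h : Q.IsStrongLabeling l) :
    Q.IsTwoOrientation (Q.inducedOrientation l) where
  isOrientation d := by
    have := h.edge_rule d.symm
    exact this
  outdegree_eq_two v h₀ h₁ := by
    obtain ⟨d, hd, k, hk, hkn, hzero, hone⟩ := h.vertex_rule v h₀ h₁
    simp only [PlaneGraph.outdegree, h.mem_inducedOrientation_iff]
    exact Q.ncard_changes hd hk hkn hzero hone

/-- The propagation rules assign to every angle exactly the label of the strong labeling. -/
theorem propagates_iff (h : Q.IsStrongLabeling l) (d : Q.Dart) (i : Fin 2) :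
    Q.Propagates (Q.inducedOrientation l) d i ↔ l d = i := by
  have hsound {d : Q.Dart} {i : Fin 2} (hp : Q.Propagates (Q.inducedOrientation l) d i) :
      l d = i := by
    induction hp with
    | start d hd => exact h.special_zero d hd
    | walk d i _ ih => rw [← ih]; exact h.walkingRule d
    | copyRight d hd i _ ih => exact (Eq.symm hd).trans ih
    | copyLeft d hd i _ ih => exact Eq.trans hd ih
  refine ⟨hsound, ?_⟩
  rintro rfl
  let S (d : Q.Dart) : Prop := ∃ i, Q.Propagates (Q.inducedOrientation l) d i
  have hnext {d : Q.Dart} (hd : S d) : S (Q.faceNext d) :=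
    hd.elim fun i hi => ⟨_, .walk d i hi⟩
  have hprev {d : Q.Dart} (hd : S (Q.faceNext d)) : S d := by
    rw [← Q.faceNext_four d]
    exact hnext (hnext (hnext hd))
  -- The edge's quadrilateral is crossed by one walking step and one copying step at the tip; the
  -- orientation decides their order.
  have hsymm {d : Q.Dart} (hd : S d) : S d.symm := by
    rcases h.isTwoOrientation.isOrientation d with ⟨hX, -⟩ | ⟨hX, -⟩
    · obtain ⟨i, hi⟩ := hnext hd
      exact ⟨i, .copyLeft d hX i hi⟩
    · obtain ⟨i, hi⟩ := hd
      refine hprev ⟨i, ?_⟩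
      exact .copyRight d.symm hX i hi
  obtain ⟨d₀, hd₀⟩ := Q.exists_dart_fst Q.s₀
  obtain ⟨i, hi⟩ : S d := by
    refine Q.dart_induction (S := S) (fun d hd => ?_) (fun d => hsymm) ⟨0, .start d₀ hd₀⟩ d
    rw [rot_eq_faceNext_symm]
    exact hnext (hsymm hd)
  rwa [hsound hi]

end IsStrongLabeling

end Labeling

/-! ### From 2-orientations to strong labelings -/

namespace IsTwoOrientation

variable {X : Set Q.Dart}

/-- Euler's formula and `2E = 4F` give `E = 2(V - 2)`, so the edges leaving the other `V - 2`
vertices already exhaust all edges. -/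
theorem outdegree_special (h : Q.IsTwoOrientation X) :
    Q.outdegree X Q.s₀ = 0 ∧ Q.outdegree X Q.s₁ = 0 := by
  classical
  have := Fintype.ofFinite V
  have hsum := Q.sum_outdegree h.isOrientation
  have hs₁ : Q.s₁ ∈ Finset.univ.erase Q.s₀ := by simp [Q.s₀_ne_s₁.symm]
  rw [← Finset.add_sum_erase _ _ (Finset.mem_univ Q.s₀), ← Finset.add_sum_erase _ _ hs₁,
    Finset.sum_congr rfl (g := fun _ => 2) (fun v hv => by
      simp only [Finset.mem_erase] at hv
      exact h.outdegree_eq_two v hv.2.1 hv.1), Finset.sum_const,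
    Finset.card_erase_of_mem hs₁, Finset.card_erase_of_mem (Finset.mem_univ _),
    Finset.card_univ, ← Nat.card_eq_fintype_card, smul_eq_mul] at hsum
  have := Q.card_euler
  have := Q.card_dart
  have := Q.card_dart_eq_four_mul
  omega

theorem notMem_of_special (h : Q.IsTwoOrientation X) {d : Q.Dart}
    (hd : d.fst = Q.s₀ ∨ d.fst = Q.s₁) : d ∉ X := by
  rcases hd with hd | hd
  · exact (Q.outdegree_eq_zero_iff X _).1 h.outdegree_special.1 d hd
  · exact (Q.outdegree_eq_zero_iff X _).1 h.outdegree_special.2 d hd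

open Classical in
/-- A labeling satisfying the walking rule and changing at the tails of the oriented edges. -/
theorem exists_labeling (h : Q.IsTwoOrientation X) (d₀ : Q.Dart) :
    ∃ l : Q.Dart → Fin 2, l d₀ = 0 ∧ (∀ d, WalkingRule Q l d) ∧
      ∀ d, l (Q.rot d) = if d ∈ X then 1 - l d else l d := by
  have := Fintype.ofFinite Q.Dart
  obtain ⟨g, hface, hrot⟩ := Q.exists_potential (fun d => if d.fst ∈ Q.black then 1 else 0)
    (fun d => if d ∈ X then 1 else 0)
    (fun f => by
      induction f using Quotient.inductionOn with
      | h d =>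
        refine (Q.sum_face _ d).trans ?_
        simp only [faceNext_fst_mem_black, not_not]
        split_ifs <;> decide)
    (fun v => by
      have hout : ((Q.outdegree X v : ℕ) : ZMod 2) = 0 := by
        by_cases h₀ : v = Q.s₀
        · rw [h₀, h.outdegree_special.1, Nat.cast_zero]
        by_cases h₁ : v = Q.s₁
        · rw [h₁, h.outdegree_special.2, Nat.cast_zero]
        rw [h.outdegree_eq_two v h₀ h₁]
        rfl
      rw [PlaneGraph.outdegree_eq_sum, Nat.cast_sum] at hout
      refine Eq.trans ?_ hout
      exact Finset.sum_congr rfl fun d _ => by split_ifs <;> simp)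
    (fun d => by
      simp only [symm_fst_mem_black]
      rcases h.isOrientation d with ⟨h₁, h₂⟩ | ⟨h₁, h₂⟩ <;>
        by_cases hb : d.fst ∈ Q.black <;> simp only [h₁, h₂, hb] <;> decide)
  let φ (x : ZMod 2) : Fin 2 := if x = 0 then 0 else 1
  have hφ : ∀ x, φ (x + 1) = 1 - φ x := by decide
  -- The potential is unique only up to a constant; subtracting `g d₀` normalizes the label of `d₀`
  -- to 0.
  refine ⟨fun d => φ (g d - g d₀), if_pos (sub_self _), fun d => ?_, fun d => ?_⟩
  · simp only [WalkingRule]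
    rw [hface, add_sub_right_comm]
    split_ifs
    · exact hφ _
    · rw [add_zero]
  · beta_reduce
    rw [hrot, add_sub_right_comm]
    split_ifs
    · exact hφ _
    · rw [add_zero]

theorem exists_isStrongLabeling (h : Q.IsTwoOrientation X) :
    ∃ l, Q.IsStrongLabeling l ∧ Q.inducedOrientation l = X := by
  obtain ⟨d₀, hd₀, hout₀⟩ := Q.s₀_outer
  obtain ⟨l, hl₀, hwalk, hrot⟩ := h.exists_labeling d₀
  have hmem (d : Q.Dart) : d ∈ X ↔ l d ≠ l (Q.rot d) := by
    rw [hrot]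
    generalize l d = x
    by_cases hd : d ∈ X
    · simp only [hd, if_true, true_iff]
      decide +revert
    · simp [hd]
  have hmem' (d : Q.Dart) : d ∈ X ↔ l d.symm = l (Q.rot d.symm) := by
    have h₁ := h.isOrientation d
    have h₂ := hmem d.symm
    rw [xor_iff_iff_not] at h₁
    tauto
  have hconst {d e : Q.Dart} (hd : d.fst = Q.s₀ ∨ d.fst = Q.s₁) (hde : d.fst = e.fst) :
      l e = l d := by
    obtain ⟨n, rfl⟩ := Q.exists_pow_rot_eq hde
    clear hde
    induction n with
    | zero => rfl
    | succ n ih =>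
      rw [pow_succ', Equiv.Perm.mul_apply, hrot, if_neg, ih]
      exact h.notMem_of_special (by rwa [Q.pow_rot_fst])
  have htwo := PlaneQuadrangulation.label_faceNext_faceNext hwalk
  have hzero (d : Q.Dart) (hd : d.fst = Q.s₀) : l d = 0 :=
    (hconst (.inl hd₀) (hd₀.trans hd.symm)).trans hl₀
  refine ⟨l, ⟨hzero, fun d hd => ?_, fun v h₀ h₁ => ?_, fun d => ?_, fun e => ?_,
    fun d _ hd => ?_⟩, Set.ext fun d => (hmem' d).symm⟩
  · obtain ⟨d₁, hd₁, hout₁⟩ := Q.s₁_outer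
    rw [hconst (.inr hd₁) (hd₁.trans hd.symm)]
    have hb₀ : d₀.fst ∈ Q.black := hd₀ ▸ Q.s₀_black
    have hb₁ : d₁.fst ∈ Q.black := hd₁ ▸ Q.s₁_black
    -- Being distinct from `s₀` and of the same colour, `s₁` is the opposite corner of the outer
    -- face, so its label is complementary.
    rcases (Q.sameFace_iff d₀ d₁).1 (hout₀.symm.trans hout₁) with rfl | rfl | rfl | rfl
    · exact absurd (hd₀.symm.trans hd₁) Q.s₀_ne_s₁
    · exact absurd hb₀ ((Q.faceNext_fst_mem_black _).1 hb₁)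
    · rw [htwo, hl₀]; rfl
    · simp only [faceNext_fst_mem_black, not_not] at hb₁
      exact absurd hb₀ hb₁
  · refine Q.exists_intervals ?_
    simpa only [PlaneGraph.outdegree, hmem] using h.outdegree_eq_two v h₀ h₁
  · have h₁ := h.isOrientation d
    have h₂ := hmem d
    have h₃ := hmem' d
    rw [xor_iff_iff_not] at h₁ ⊢
    tauto
  -- The step from a white corner keeps its label, so `0011` starts at the white corner labeled 0:
  -- either `d` or the one opposite.
  · have hwhite (d : Q.Dart) (hd : d.fst ∉ Q.black) : ∃ d', Q.SameFace d d' ∧ l d' = 0 ∧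
        l (Q.faceNext d') = 0 ∧ l ((Q.faceNext ^ 2) d') = 1 ∧ l ((Q.faceNext ^ 3) d') = 1 := by
      have hd' := (hwalk d).white hd
      have hcube (e : Q.Dart) : l ((Q.faceNext ^ 3) e) = 1 - l (Q.faceNext e) := htwo _
      have hsq (e : Q.Dart) : l ((Q.faceNext ^ 2) e) = 1 - l e := htwo e
      by_cases hl : l d = 0
      · refine ⟨d, .refl _ _, ?_⟩
        rw [hcube, hsq, hd', hl]
        decide
      · refine ⟨Q.faceNext (Q.faceNext d), (Q.sameFace_iff _ _).2 (by simp), ?_⟩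
        rw [hcube, hsq, htwo, htwo, hd']
        generalize l d = x at hl
        decide +revert
    by_cases hb : e.fst ∈ Q.black
    · obtain ⟨d, hd, hlab⟩ := hwhite (Q.faceNext e)
        (by simpa only [faceNext_fst_mem_black, not_not] using hb)
      exact ⟨d, Equiv.Perm.sameCycle_apply_left.1 hd, hlab⟩
    · exact hwhite e hb
  · have hb : d.fst ∈ Q.black := hd ▸ Q.s₀_black
    rw [faceNext_inv_cube, faceNext_inv_sq, faceNext_inv, htwo, (hwalk d).black hb, htwo,
      hzero d hd]
    decide

end IsTwoOrientation

end PlaneQuadrangulation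

/-! ### The bijection -/

theorem mainTheorem4 {V : Type*} [Finite V] (Q : PlaneQuadrangulation V) :
    ∃ e : {l : Q.Dart → Fin 2 // Q.IsStrongLabeling l} ≃ {X : Set Q.Dart // Q.IsTwoOrientation X},
      (∀ l, (e l).1 = Q.inducedOrientation l.1) ∧
      (∀ X d i, Q.Propagates X.1 d i ↔ (e.symm X).1 d = i) := by
  let f : {l : Q.Dart → Fin 2 // Q.IsStrongLabeling l} → {X : Set Q.Dart // Q.IsTwoOrientation X} :=
    fun l => ⟨Q.inducedOrientation l.1, l.2.isTwoOrientation⟩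
  have hf : Function.Bijective f := by
    constructor
    · intro l l' h
      refine Subtype.ext (funext fun d => ?_)
      -- Propagation depends on the orientation alone, so equal orientations give equal labels.
      have hp := (l.2.propagates_iff d (l.1 d)).2 rfl
      rw [show Q.inducedOrientation l.1 = Q.inducedOrientation l'.1 from congrArg Subtype.val h,
        l'.2.propagates_iff] at hp
      exact hp.symm
    · rintro ⟨X, hX⟩
      obtain ⟨l, hl, rfl⟩ := hX.exists_isStrongLabeling
      exact ⟨⟨l, hl⟩, rfl⟩
  refine ⟨Equiv.ofBijective f hf, fun l => rfl, fun X d i => ?_⟩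
  obtain ⟨l, rfl⟩ := (Equiv.ofBijective f hf).surjective X
  rw [Equiv.symm_apply_apply]
  exact l.2.propagates_iff d i
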